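/- **Definitions.** For a finite nonempty set $A\subset\mathbb{R}^n_{\ge 0}$ let $\Pi(A)$ be the set of all $x$ with $0\le x_i\le\max\{y_i\mid y\in A\}$ for $i=1,\dots,n$. For $S\subset\mathbb{R}^n_{\ge0}$ let $\mathrm{Vrm}(S)$ (the Voronoi relative minima) be the set of all $p\in S$ such that $\Pi(\{p\})$ contains no point of $S\setminus\{p\}$. A finite set $F\subset\mathrm{Vrm}(S)$ is *minimal* if $\Pi(F)$ contains no point of $\mathrm{Vrm}(S)\setminus F$. The Minkowski–Voronoi complex $MV(S)$ has one face of dimension $n-k$ for each minimal $k$-element set, $1\le k\le n$; the face of $F_1$ is adjacent to the face of $F_2\neq F_1$ (with the face of $F_2$ in the closure of the face of $F_1$) if and only if $F_1\subset F_2$. A face is *irredundant* if all nonempty subsets of the minimal set labelling it are minimal. Two complexes are combinatorially equivalent ($\approx$) if there is a bijection between their faces that preserves, in both directions, adjacency, dimension and irredundancy; in particular it restricts to a combinatorial equivalence between the complexes formed by the irredundant faces alone. For a lattice $\Gamma\subset\mathbb{R}^n$ put $MV(\Gamma)=MV(|\Gamma|)$, where $|\Gamma|=\{(|x_1|,\dots,|x_n|)\mid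 x\in\Gamma\}\setminus\{0\}$. For integers $a,b\ge0$, $N\ge1$ let $$\Gamma(a,b,N)=\{m_1(1,a,b)+m_2(0,N,0)+m_3(0,0,N)\mid m_1,m_2,m_3\in\mathbb{Z}\}.$$ **Theorem (Minkowski–Voronoi complex stabilization).** Let $\alpha,\beta,\gamma,a$ be nonnegative integers with $\alpha>0$, $0\le\beta<\alpha a$, $0\le\gamma<a$, $\gcd(\alpha,\beta)=1$ and $\gcd(a,\alpha+\beta\gamma)=1$. For integers $t,u\ge0$ set $b(t)=\alpha a t+\beta$, $N(t,u)=b(t)(au+\gamma)+\alpha$ and $\Gamma_{t,u}=\Gamma\big(a,b(t),N(t,u)\big)$. Then: 1. ($(t,u)$-stabilization) there exist $t_0,u_0\ge0$ such that $MV(\Gamma_{t,u})\approx MV(\Gamma_{t_0,u_0})$ for all $t>t_0$ and $u>u_0$; 2. ($t$-stabilization) for every $u\ge0$ there exists $t_0\ge0$ such that $MV(\Gamma_{t,u})\approx MV(\Gamma_{t_0,u})$ for all $t>t_0$; 3. ($u$-stabilization) for every $t\ge0$ there exists $u_0\ge0$ such that $MV(\Gamma_{t,u})\approx MV(\Gamma_{t,u_0})$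 for all $u>u_0$; 4. the complexes $MV(\Gamma_{t,u})$, $t,u\ge0$, fall into only finitely many combinatorial types: there is a finite set $P$ of pairs of nonnegative integers such that for all $t,u\ge0$ there is $(t',u')\in P$ with $MV(\Gamma_{t,u})\approx MV(\Gamma_{t',u'})$. -/

import Mathlib

namespace MinkowskiVoronoi

/-- The parallelepiped `Π(A)` of a finite nonempty set `A` of points with nonnegative coordinates:
all `x` with `0 ≤ x i ≤ max {y i | y ∈ A}` for every `i`
(being at most the maximum means being at most one of the values). -/
def box {n : ℕ} (A : Finset (Fin n → ℝ)) : Set (Fin n → ℝ) :=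
  {x | ∀ i, 0 ≤ x i ∧ ∃ y ∈ A, x i ≤ y i}

/-- `Vrm(S)`: the Voronoi relative minima of `S`, the points `p` of `S` for which `Π({p})`
contains no point of `S` other than `p`. -/
def relMin {n : ℕ} (S : Set (Fin n → ℝ)) : Set (Fin n → ℝ) :=
  {p | p ∈ S ∧ ∀ x ∈ S, x ≠ p → x ∉ box {p}}

/-- A finite set `F` of relative minima is minimal if `Π(F)` contains no relative minimum
outside `F`. -/
def IsMinimal {n : ℕ} (S : Set (Fin n → ℝ)) (F : Finset (Fin n → ℝ)) : Prop :=
  (∀ x ∈ F, x ∈ relMin S) ∧ ∀ x ∈ relMin S, x ∉ F → x ∉ box F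

/-- The faces of the Minkowski--Voronoi complex `MV(S)`: one face of dimension `n - k` for every
minimal `k`-element subset, `1 ≤ k ≤ n`. -/
@[ext]
structure Face {n : ℕ} (S : Set (Fin n → ℝ)) where
  /-- the minimal subset that labels the face -/
  pts : Finset (Fin n → ℝ)
  nonempty : pts.Nonempty
  card_le : pts.card ≤ n
  minimal : IsMinimal S pts

/-- The dimension of a face. -/
def Face.dim {n : ℕ} {S : Set (Fin n → ℝ)} (c : Face S) : ℕ := n - c.pts.card

/-- A face is irredundant if all nonempty subsets of its label are minimal subsets too,
that is, if no point of the label lies in the parallelepiped of others. -/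
def Face.Irredundant {n : ℕ} {S : Set (Fin n → ℝ)} (c : Face S) : Prop :=
  ∀ G : Finset (Fin n → ℝ), G ⊆ c.pts → G.Nonempty → IsMinimal S G

/-- The face order: the face of `F₂` lies in the closure of the face of `F₁` iff `F₁ ⊆ F₂`
(vertices are at the bottom). -/
instance {n : ℕ} (S : Set (Fin n → ℝ)) : PartialOrder (Face S) where
  le c d := d.pts ⊆ c.pts
  le_refl c := Finset.Subset.refl c.pts
  le_trans _ _ _ h₁ h₂ := Finset.Subset.trans h₂ h₁
  le_antisymm _ _ h₁ h₂ := Face.ext (Finset.Subset.antisymm h₂ h₁)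

/-- Combinatorial equivalence of `MV(S)` and `MV(T)`: a bijection between the faces that preserves
adjacency and dimension. It is moreover asked to match irredundant faces with irredundant faces,
so that it restricts to a combinatorial equivalence of the complexes of irredundant faces. -/
def CombEquiv {n : ℕ} (S T : Set (Fin n → ℝ)) : Prop :=
  ∃ e : Face S ≃o Face T, ∀ c : Face S,
    (e c).dim = c.dim ∧ ((e c).Irredundant ↔ c.Irredundant)

/-- The set `|Γ|` of the nonzero vectors `(|x₁|, …, |xₙ|)`, `x ∈ Γ`. -/
def absSet {n : ℕ} (Γ : Set (Fin n → ℝ)) : Set (Fin n → ℝ) :=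
  {v | v ≠ 0 ∧ ∃ x ∈ Γ, v = fun i => |x i|}

/-- The rank-1 lattice `Γ(a, b, N)`. -/
def rankOneLattice (a b N : ℕ) : Set (Fin 3 → ℝ) :=
  {v | ∃ m₁ m₂ m₃ : ℤ,
    v = (m₁ : ℝ) • ![1, (a : ℝ), (b : ℝ)] + (m₂ : ℝ) • ![0, (N : ℝ), 0]
      + (m₃ : ℝ) • ![0, 0, (N : ℝ)]}

/-- `MV(Γ) ≈ MV(Γ')` for lattices, where `MV(Γ) = MV(|Γ|)`. -/
def LatticeEquiv {n : ℕ} (Γ Γ' : Set (Fin n → ℝ)) : Prop :=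
  CombEquiv (absSet Γ) (absSet Γ')

/-- `b(t) = α a t + β`. -/
def bPar (α β a t : ℕ) : ℕ := α * a * t + β

/-- `N(t, u) = b(t) (a u + γ) + α`. -/
def NPar (α β γ a t u : ℕ) : ℕ := bPar α β a t * (a * u + γ) + α

/-- The lattice `Γ(a, b(t), N(t, u))`. -/
def familyLattice (α β γ a t u : ℕ) : Set (Fin 3 → ℝ) :=
  rankOneLattice a (bPar α β a t) (NPar α β γ a t u)

end MinkowskiVoronoi

/-!
Write `b = b(t)` and `M = M(u) = a u + γ`, so that `N = b M + α`. The complex of a set `S` depends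
only on the relative minima of `S` and on the order of their coordinates in each direction. So it
suffices to exhibit finitely many families of lattice vectors, the *templates*, given by explicit
formulas in `t` and `u`, such that

* every nonzero lattice vector is dominated in absolute value, coordinate by coordinate, by a
  nonzero template (`exists_template_le`), and
* each comparison between coordinates of two templates is eventually constant.

The relative minima are then the minimal templates, and matching each template at `(t, u)` with the
same template at `(t', u')` gives the equivalence (`Matching.combEquiv`, `latticeEquiv_of_le_iff`).

For domination, let `(x, y, z)` be a lattice vector with all coordinates less than `N` in absolute
value; otherwise `N` times a unit vector dominates it. If `|y| ≤ a`, then `a x` and `a z` are, up to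
bounded multiples of `1` and `b`, bounded multiples of `N` (`exists_template_of_second_le`); if
`|z| ≤ α`, the same holds for `α x` and `α y` because `b M ≡ -α` modulo `N`
(`exists_template_of_third_le`). Otherwise `(1, a, b)` dominates the vector unless `|z| < b`, which
forces `|x| ≥ M`; then `(M, a M, -α)` dominates it unless `|y| < a M`. In that last case `b y - a z`
is a multiple of `N` of size `O(a N)`, and the vector has bounded coordinates in a suitable basis of
the lattice (`exists_template_of_lt`). All bounds are uniform in `t` and `u` as long as `b` and `M`
are positive.

The coordinates of templates have the form `M (A t + B) + C` or `b (A M + B) + C`, and so have sums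
and differences of them. Their signs are eventually constant when `t` and `u` both tend to infinity,
and when one of them does and the other is fixed. If `b = 0` or `M = 0`, then `N = α` and the
lattice itself does not change. Finiteness of the number of types is a formal consequence
of the three stabilization statements (`exists_finset_of_stable`).
-/

namespace MinkowskiVoronoi

/-! ### Transporting the complex along a system of dominating points -/

lemma mem_box_singleton {n : ℕ} {x p : Fin n → ℝ} (hx : ∀ i, 0 ≤ x i) :
    x ∈ box {p} ↔ x ≤ p := by
  simp [box, hx, Pi.le_def]

/-- The families `C` and `D` have the same order pattern in every coordinate, corresponding
members lie in `S` and in `T`, and every point of `S` (of `T`) lies coordinatewise above a point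
of `S` from `C` (of `T` from `D`). Then the relative minima of `S` are the minimal points of `S`
among the `C j`, and `C j ↦ D j` carries them to the relative minima of `T`. -/
structure Matching {n : ℕ} {J : Type*} (S T : Set (Fin n → ℝ)) (C D : J → Fin n → ℝ) : Prop where
  nonneg_left : ∀ x ∈ S, ∀ i, 0 ≤ x i
  nonneg_right : ∀ x ∈ T, ∀ i, 0 ≤ x i
  mem_iff : ∀ j, C j ∈ S ↔ D j ∈ T
  le_iff : ∀ j k i, C j i ≤ C k i ↔ D j i ≤ D k i
  dominated_left : ∀ x ∈ S, ∃ j, C j ∈ S ∧ C j ≤ x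
  dominated_right : ∀ x ∈ T, ∃ j, D j ∈ T ∧ D j ≤ x

namespace Matching

variable {n : ℕ} {J : Type*} {S T : Set (Fin n → ℝ)} {C D : J → Fin n → ℝ}

lemma symm (h : Matching S T C D) : Matching T S D C :=
  ⟨h.nonneg_right, h.nonneg_left, fun j => (h.mem_iff j).symm,
    fun j k i => (h.le_iff j k i).symm, h.dominated_right, h.dominated_left⟩

lemma le_iff' (h : Matching S T C D) (j k : J) : C j ≤ C k ↔ D j ≤ D k := by
  simp only [Pi.le_def, h.le_iff]

lemma factorsThrough (h : Matching S T C D) : Function.FactorsThrough D C := fun j k hjk =>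
  le_antisymm ((h.le_iff' j k).1 hjk.le) ((h.le_iff' k j).1 hjk.ge)

/-- The map `C j ↦ D j`, extended arbitrarily. -/
noncomputable def toFun (_ : Matching S T C D) : (Fin n → ℝ) → (Fin n → ℝ) :=
  Function.extend C D 0

lemma toFun_apply (h : Matching S T C D) (j : J) : h.toFun (C j) = D j :=
  h.factorsThrough.extend_apply 0 j

lemma exists_eq (h : Matching S T C D) {x : Fin n → ℝ} (hx : x ∈ relMin S) :
    ∃ j, C j = x := by
  obtain ⟨j, hj, hjx⟩ := h.dominated_left x hx.1
  refine ⟨j, by_contra fun hne => hx.2 _ hj hne ?_⟩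
  exact (mem_box_singleton (h.nonneg_left _ hj)).2 hjx

lemma apply_mem_relMin (h : Matching S T C D) {j : J} (hj : C j ∈ relMin S) :
    D j ∈ relMin T := by
  refine ⟨(h.mem_iff j).1 hj.1, fun y hy hne hyb => hne ?_⟩
  have hyj := (mem_box_singleton (h.nonneg_right y hy)).1 hyb
  obtain ⟨k, hk, hky⟩ := h.dominated_right y hy
  have hkS := (h.mem_iff k).2 hk
  have hkj : C k ≤ C j := (h.le_iff' k j).2 (hky.trans hyj)
  have hC : C k = C j := by_contra fun hne' =>
    hj.2 _ hkS hne' ((mem_box_singleton (h.nonneg_left _ hkS)).2 hkj)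
  exact le_antisymm hyj (h.factorsThrough hC ▸ hky)

lemma toFun_mem_relMin (h : Matching S T C D) {x : Fin n → ℝ} (hx : x ∈ relMin S) :
    h.toFun x ∈ relMin T := by
  obtain ⟨j, rfl⟩ := h.exists_eq hx
  rw [h.toFun_apply]
  exact h.apply_mem_relMin hx

lemma toFun_toFun (h : Matching S T C D) {x : Fin n → ℝ} (hx : x ∈ relMin S) :
    h.symm.toFun (h.toFun x) = x := by
  obtain ⟨j, rfl⟩ := h.exists_eq hx
  rw [h.toFun_apply, h.symm.toFun_apply]

open Classical in
lemma image_image (h : Matching S T C D) {F : Finset (Fin n → ℝ)} (hF : ∀ x ∈ F, x ∈ relMin S) :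
    (F.image h.toFun).image h.symm.toFun = F := by
  rw [Finset.image_image]
  ext x
  simp only [Finset.mem_image, Function.comp_apply]
  constructor
  · rintro ⟨y, hy, rfl⟩
    rwa [h.toFun_toFun (hF y hy)]
  · exact fun hx => ⟨x, hx, h.toFun_toFun (hF x hx)⟩

open Classical in
lemma isMinimal_image (h : Matching S T C D) {F : Finset (Fin n → ℝ)} (hF : IsMinimal S F) :
    IsMinimal T (F.image h.toFun) := by
  refine ⟨fun x hx => ?_, fun x hx hxF hxb => ?_⟩
  · obtain ⟨y, hy, rfl⟩ := Finset.mem_image.1 hx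
    exact h.toFun_mem_relMin (hF.1 y hy)
  · obtain ⟨k, rfl⟩ := h.symm.exists_eq hx
    have hk := h.symm.apply_mem_relMin hx
    refine hF.2 _ hk (fun hkF => hxF ?_) fun i => ⟨h.nonneg_left _ hk.1 i, ?_⟩
    · exact Finset.mem_image.2 ⟨_, hkF, h.toFun_apply k⟩
    · obtain ⟨y, hy, hle⟩ := (hxb i).2
      obtain ⟨z, hz, rfl⟩ := Finset.mem_image.1 hy
      obtain ⟨l, rfl⟩ := h.exists_eq (hF.1 z hz)
      rw [h.toFun_apply] at hle
      exact ⟨_, hz, (h.le_iff k l i).2 hle⟩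

lemma injOn (h : Matching S T C D) {F : Finset (Fin n → ℝ)} (hF : ∀ x ∈ F, x ∈ relMin S) :
    Set.InjOn h.toFun F := fun x hx y hy hxy => by
  rw [← h.toFun_toFun (hF x hx), hxy, h.toFun_toFun (hF y hy)]

open Classical in
/-- The map of faces that applies `C j ↦ D j` to the points of the label. -/
noncomputable def mapFace (h : Matching S T C D) (c : Face S) : Face T where
  pts := c.pts.image h.toFun
  nonempty := c.nonempty.image _
  card_le := Finset.card_image_le.trans c.card_le
  minimal := h.isMinimal_image c.minimal

lemma mapFace_mapFace (h : Matching S T C D) (c : Face S) :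
    h.symm.mapFace (h.mapFace c) = c :=
  Face.ext (h.image_image c.minimal.1)

lemma mapFace_mono (h : Matching S T C D) {c d : Face S} (hcd : c ≤ d) :
    h.mapFace c ≤ h.mapFace d :=
  Finset.image_subset_image (f := h.toFun) (show d.pts ⊆ c.pts from hcd)

lemma irredundant_mapFace (h : Matching S T C D) {c : Face S} (hc : c.Irredundant) :
    (h.mapFace c).Irredundant := by
  classical
  intro G hG hne
  have hGT : ∀ x ∈ G, x ∈ relMin T := fun x hx => (h.mapFace c).minimal.1 x (hG hx)
  have hsub : G.image h.symm.toFun ⊆ c.pts := by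
    rw [← h.image_image c.minimal.1]
    exact Finset.image_subset_image hG
  have := h.isMinimal_image (hc _ hsub (hne.image _))
  rwa [h.symm.image_image hGT] at this

theorem combEquiv (h : Matching S T C D) : CombEquiv S T := by
  refine ⟨⟨⟨h.mapFace, h.symm.mapFace, h.mapFace_mapFace, h.symm.mapFace_mapFace⟩,
    fun {c d} => ⟨fun hcd => ?_, h.mapFace_mono⟩⟩, fun c => ⟨?_, fun hc => ?_, ?_⟩⟩
  · have := h.symm.mapFace_mono hcd
    simpa only [Equiv.coe_fn_mk, h.mapFace_mapFace] using this
  · classical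
    exact congrArg (n - ·) (Finset.card_image_of_injOn (h.injOn c.minimal.1))
  · have := h.symm.irredundant_mapFace hc
    exact h.mapFace_mapFace c ▸ this
  · exact h.irredundant_mapFace

end Matching

/-! ### Eventually constant signs -/

open Filter

/-- The sign of `f` is eventually constant along `l`. -/
def SignStable {σ : Type*} (l : Filter σ) (f : σ → ℝ) : Prop :=
  (∀ᶠ s in l, 0 < f s) ∨ (∀ᶠ s in l, f s = 0) ∨ ∀ᶠ s in l, f s < 0

section SignStable

variable {σ : Type*} {l : Filter σ}

lemma SignStable.of_neg {f : σ → ℝ} (h : SignStable l fun s => -f s) : SignStable l f := by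
  unfold SignStable at *
  simp only [Left.neg_pos_iff, neg_eq_zero, Left.neg_neg_iff] at h
  tauto

lemma signStable_const (C : ℝ) : SignStable l fun _ => C := by
  rcases lt_trichotomy C 0 with h | h | h
  · exact Or.inr (Or.inr (Eventually.of_forall fun _ => h))
  · exact Or.inr (Or.inl (Eventually.of_forall fun _ => h))
  · exact Or.inl (Eventually.of_forall fun _ => h)

lemma signStable_affine {Q : σ → ℝ} (hQ : Tendsto Q l atTop) (A B : ℝ) :
    SignStable l fun s => A * Q s + B := by
  wlog hA : 0 ≤ A generalizing A B
  · refine SignStable.of_neg ?_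
    have := this (-A) (-B) (by linarith)
    convert this using 2 with s
    ring
  rcases hA.eq_or_lt with rfl | hA
  · simpa using signStable_const B
  · exact Or.inl ((tendsto_atTop_add_const_right l B (hQ.const_mul_atTop hA)).eventually_gt_atTop 0)

/-- The sign is that of the first nonzero coefficient among `A`, `B`, `C`. -/
lemma signStable_biaffine {P Q : σ → ℝ} (hP : Tendsto P l atTop) (hQ : Tendsto Q l atTop)
    (A B C : ℝ) : SignStable l fun s => P s * (A * Q s + B) + C := by
  wlog hA : 0 ≤ A generalizing A B C
  · refine SignStable.of_neg ?_
    have := this (-A) (-B) (-C) (by linarith)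
    convert this using 2 with s
    ring
  rcases hA.eq_or_lt with rfl | hA
  · convert signStable_affine hP B C using 2 with s
    ring
  · exact Or.inl ((tendsto_atTop_add_const_right l C (hP.atTop_mul_atTop₀
      (tendsto_atTop_add_const_right l B (hQ.const_mul_atTop hA)))).eventually_gt_atTop 0)

lemma SignStable.mul {f g : σ → ℝ} (hf : SignStable l f) (hg : SignStable l g) :
    SignStable l fun s => f s * g s := by
  rcases hf with hf | hf | hf <;> rcases hg with hg | hg | hg
  all_goals first
    | exact Or.inl ((hf.and hg).mono fun s h => mul_pos h.1 h.2)
    | exact Or.inl ((hf.and hg).mono fun s h => mul_pos_of_neg_of_neg h.1 h.2)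
    | exact Or.inr (Or.inl (hf.mono fun s h => mul_eq_zero_of_left h _))
    | exact Or.inr (Or.inl (hg.mono fun s h => mul_eq_zero_of_right _ h))
    | exact Or.inr (Or.inr ((hf.and hg).mono fun s h => mul_neg_of_pos_of_neg h.1 h.2))
    | exact Or.inr (Or.inr ((hf.and hg).mono fun s h => mul_neg_of_neg_of_pos h.1 h.2))

/-- `|f| ≤ |g|` says that `(f - g) * (f + g) ≤ 0`, so its truth value depends on two signs only. -/
lemma exists_eventually_abs_le_iff {f g : σ → ℝ} (h₁ : SignStable l fun s => f s - g s)
    (h₂ : SignStable l fun s => f s + g s) : ∃ c : Prop, ∀ᶠ s in l, (|f s| ≤ |g s| ↔ c) := by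
  have key : ∀ s, |f s| ≤ |g s| ↔ (f s - g s) * (f s + g s) ≤ 0 := fun s => by
    rw [← sq_le_sq, ← sub_nonpos]
    ring_nf
  simp only [key]
  rcases h₁.mul h₂ with h | h | h
  · exact ⟨False, h.mono fun s hs => iff_false_intro hs.not_ge⟩
  · exact ⟨True, h.mono fun s hs => iff_true_intro hs.le⟩
  · exact ⟨True, h.mono fun s hs => iff_true_intro hs.le⟩

end SignStable

/-! ### The templates -/

section Templates

variable (α β γ a : ℕ)

/-- `M(u) = a u + γ`, so that `N = b M + α`. -/
def MPar (u : ℕ) : ℕ := a * u + γ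

/-- The lattice vectors `(x, y, z)` with `y` bounded: `x` and `z` are recovered from
`a x ≡ y` and `a z ≡ b y` modulo `N`. -/
noncomputable def secondSmall (k r c : ℤ) (s : ℕ × ℕ) : Fin 3 → ℝ :=
  ![((NPar α β γ a s.1 s.2 : ℝ) * k + r) / a, r,
    ((NPar α β γ a s.1 s.2 : ℝ) * c + bPar α β a s.1 * r) / a]

/-- The lattice vectors `(x, y, z)` with `z` bounded: as `b M ≡ -α`, the coordinates `x` and `y`
are recovered from `α x ≡ -M z` and `α y ≡ -a M z` modulo `N`. -/
noncomputable def thirdSmall (e d r : ℤ) (s : ℕ × ℕ) : Fin 3 → ℝ :=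
  ![((NPar α β γ a s.1 s.2 : ℝ) * e - MPar γ a s.2 * r) / α,
    ((NPar α β γ a s.1 s.2 : ℝ) * d - a * MPar γ a s.2 * r) / α, r]

/-- The combinations of the lattice basis `(1, a, b)`, `(M, a M, -α)`,
`(-α t M, β M + α, α² t)`. -/
noncomputable def basisComb (p q m : ℤ) (s : ℕ × ℕ) : Fin 3 → ℝ :=
  ![p + MPar γ a s.2 * (q - m * α * s.1), a * p + α * m + MPar γ a s.2 * (a * q + β * m),
    bPar α β a s.1 * p - q * α + α ^ 2 * s.1 * m]

/-- A bound for the parameters of the templates that does not depend on `t` and `u`: the sum of the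
bounds that arise for the individual parameters. -/
def templateBound : ℤ := 1 + 4 * a + 2 * α + α * a + 2 * a * β + α * (4 * a + 2 * a * β)

/-- The templates: finitely many families of vectors indexed by `(t, u)`. The divisibilities, which
do not involve `t` and `u`, make them families of lattice vectors. -/
def templates : Set (ℕ × ℕ → Fin 3 → ℝ) :=
  {F | ∃ i j k : ℤ, |i| ≤ templateBound α β a ∧ |j| ≤ templateBound α β a ∧
    |k| ≤ templateBound α β a ∧
    (((a : ℤ) ∣ (α + β * γ) * i + j ∧ (a : ℤ) ∣ k - β * i ∧ F = secondSmall α β γ a i j k) ∨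
     ((α : ℤ) ∣ i * β - k ∧ (α : ℤ) ∣ j - a * i ∧ F = thirdSmall α β γ a i j k) ∨
     F = basisComb α β γ a i j k)}

lemma templateBound_pos : 0 < templateBound α β a := by
  unfold templateBound
  positivity

lemma finite_templates : (templates α β γ a).Finite := by
  let B := Set.Icc (-templateBound α β a) (templateBound α β a)
  have hB : (B ×ˢ B ×ˢ B).Finite :=
    (Set.finite_Icc _ _).prod ((Set.finite_Icc _ _).prod (Set.finite_Icc _ _))
  refine ((hB.image fun x => secondSmall α β γ a x.1 x.2.1 x.2.2).union
    ((hB.image fun x => thirdSmall α β γ a x.1 x.2.1 x.2.2).union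
      (hB.image fun x => basisComb α β γ a x.1 x.2.1 x.2.2))).subset ?_
  rintro F ⟨i, j, k, hi, hj, hk, h⟩
  have hm : (i, j, k) ∈ B ×ˢ B ×ˢ B := ⟨abs_le.1 hi, abs_le.1 hj, abs_le.1 hk⟩
  rcases h with ⟨-, -, rfl⟩ | ⟨-, -, rfl⟩ | rfl
  · exact Or.inl ⟨_, hm, rfl⟩
  · exact Or.inr (Or.inl ⟨_, hm, rfl⟩)
  · exact Or.inr (Or.inr ⟨_, hm, rfl⟩)

lemma zero_mem_templates : (0 : ℕ × ℕ → Fin 3 → ℝ) ∈ templates α β γ a := by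
  have h := (templateBound_pos α β a).le
  refine ⟨0, 0, 0, by simpa, by simpa, by simpa, Or.inr (Or.inr ?_)⟩
  funext s i
  fin_cases i <;> simp [basisComb]

variable {α β γ a}

lemma mem_familyLattice {t u : ℕ} {v : Fin 3 → ℝ} :
    v ∈ familyLattice α β γ a t u ↔ ∃ x j l : ℤ,
      v = ![(x : ℝ), a * x + NPar α β γ a t u * j, bPar α β a t * x + NPar α β γ a t u * l] := by
  have h : ∀ x j l : ℤ, (x : ℝ) • ![(1 : ℝ), (a : ℝ), (bPar α β a t : ℝ)]
      + (j : ℝ) • ![(0 : ℝ), (NPar α β γ a t u : ℝ), 0]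
      + (l : ℝ) • ![(0 : ℝ), 0, (NPar α β γ a t u : ℝ)] =
      ![(x : ℝ), a * x + NPar α β γ a t u * j, bPar α β a t * x + NPar α β γ a t u * l] := by
    intro x j l
    ext i
    fin_cases i <;> simp <;> ring
  simp only [familyLattice, rankOneLattice, Set.mem_ofPred_eq, h]

lemma NPar_eq (t u : ℕ) :
    NPar α β γ a t u = bPar α β a t * MPar γ a u + α := rfl

/-- Along a family of lattice vectors with bounded second coordinate, membership is governed by
congruences modulo `a`, where `N ≡ α + β γ` and `b ≡ β`. -/
lemma secondSmall_mem (ha : 0 < a) {k r c : ℤ} (h₁ : (a : ℤ) ∣ (α + β * γ) * k + r)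
    (h₂ : (a : ℤ) ∣ c - β * k) (s : ℕ × ℕ) :
    secondSmall α β γ a k r c s ∈ familyLattice α β γ a s.1 s.2 := by
  obtain ⟨e, he⟩ := h₁
  obtain ⟨f, hf⟩ := h₂
  obtain ⟨t, u⟩ := s
  have ha' : (a : ℝ) ≠ 0 := by positivity
  have hr : (r : ℝ) = a * e - (α + β * γ) * k := by
    rw [eq_sub_iff_add_eq]; exact_mod_cast (add_comm _ _).trans he
  have hc : (c : ℝ) = a * f + β * k := by
    rw [← sub_eq_iff_eq_add]; exact_mod_cast hf
  refine mem_familyLattice.2 ⟨e + (α * t * (a * u + γ) + β * u) * k, -k, f - α * t * k, ?_⟩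
  ext i
  fin_cases i <;> simp [secondSmall, NPar, bPar, hr, hc] <;> field_simp <;> ring

/-- The analogue modulo `α`, where `N ≡ b M` and `b ≡ β`. -/
lemma thirdSmall_mem (hα : 0 < α) {e d r : ℤ} (h₁ : (α : ℤ) ∣ e * β - r)
    (h₂ : (α : ℤ) ∣ d - a * e) (s : ℕ × ℕ) :
    thirdSmall α β γ a e d r s ∈ familyLattice α β γ a s.1 s.2 := by
  obtain ⟨f, hf⟩ := h₁
  obtain ⟨g, hg⟩ := h₂
  obtain ⟨t, u⟩ := s
  have hα' : (α : ℝ) ≠ 0 := by positivity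
  have hr : (r : ℝ) = e * β - α * f := by
    rw [eq_sub_iff_add_eq, ← eq_sub_iff_add_eq']; exact_mod_cast hf.symm
  have hd : (d : ℝ) = α * g + a * e := by
    rw [← sub_eq_iff_eq_add]; exact_mod_cast hg
  refine mem_familyLattice.2
    ⟨e + (a * t * e + f) * (a * u + γ), g, -(a * t * e + f), ?_⟩
  ext i
  fin_cases i <;> simp [thirdSmall, NPar, bPar, MPar, hr, hd] <;> field_simp <;> ring

lemma basisComb_mem (p q m : ℤ) (s : ℕ × ℕ) :
    basisComb α β γ a p q m s ∈ familyLattice α β γ a s.1 s.2 := by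
  obtain ⟨t, u⟩ := s
  refine mem_familyLattice.2 ⟨p + (a * u + γ) * (q - m * α * t), m, m * α * t - q, ?_⟩
  ext i
  fin_cases i <;> simp [basisComb, NPar, bPar, MPar] <;> ring

lemma mem_familyLattice_of_mem_templates (hα : 0 < α) (ha : 0 < a) {F : ℕ × ℕ → Fin 3 → ℝ}
    (hF : F ∈ templates α β γ a) (s : ℕ × ℕ) : F s ∈ familyLattice α β γ a s.1 s.2 := by
  obtain ⟨i, j, k, -, -, -, h⟩ := hF
  rcases h with ⟨h₁, h₂, rfl⟩ | ⟨h₁, h₂, rfl⟩ | rfl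
  · exact secondSmall_mem ha h₁ h₂ s
  · exact thirdSmall_mem hα h₁ h₂ s
  · exact basisComb_mem i j k s

variable (α β γ a) in
/-- The functions `M (A t + B) + C`, which occur as first and second coordinates of templates, and
the functions `b (A M + B) + C`, which occur as third coordinates. -/
noncomputable def coordForm (i : Fin 3) (A B C : ℝ) (s : ℕ × ℕ) : ℝ :=
  if i = 2 then bPar α β a s.1 * (A * MPar γ a s.2 + B) + C
  else MPar γ a s.2 * (A * s.1 + B) + C

lemma exists_coordForm (hα : 0 < α) (ha : 0 < a) {F : ℕ × ℕ → Fin 3 → ℝ}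
    (hF : F ∈ templates α β γ a) (i : Fin 3) :
    ∃ A B C : ℝ, ∀ s, F s i = coordForm α β γ a i A B C s := by
  have ha' : (a : ℝ) ≠ 0 := by positivity
  have hα' : (α : ℝ) ≠ 0 := by positivity
  obtain ⟨k, r, c, -, -, -, h⟩ := hF
  rcases h with ⟨-, -, rfl⟩ | ⟨-, -, rfl⟩ | rfl
  · fin_cases i
    · refine ⟨α * k, β * k / a, (α * k + r) / a, fun s => ?_⟩
      simp [secondSmall, coordForm, NPar_eq, bPar]
      field_simp
      ring
    · exact ⟨0, 0, r, fun s => by simp [secondSmall, coordForm]⟩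
    · refine ⟨c / a, r / a, α * c / a, fun s => ?_⟩
      simp [secondSmall, coordForm, NPar_eq]
      field_simp
      ring
  · fin_cases i
    · refine ⟨a * k, (β * k - c) / α, k, fun s => ?_⟩
      simp [thirdSmall, coordForm, NPar_eq, bPar]
      field_simp
      ring
    · refine ⟨a * r, (β * r - a * c) / α, r, fun s => ?_⟩
      simp [thirdSmall, coordForm, NPar_eq, bPar]
      field_simp
      ring
    · exact ⟨0, 0, c, fun s => by simp [thirdSmall, coordForm]⟩
  · fin_cases i
    · refine ⟨-c * α, r, k, fun s => ?_⟩
      simp [basisComb, coordForm]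
      ring
    · refine ⟨0, a * r + β * c, a * k + α * c, fun s => ?_⟩
      simp [basisComb, coordForm]
      ring
    · refine ⟨0, k + α * c / a, -r * α - α * β * c / a, fun s => ?_⟩
      simp [basisComb, coordForm, bPar]
      field_simp
      ring

end Templates

/-! ### Every lattice point is dominated by a template -/

section Domination

variable {α β γ a : ℕ}

lemma abs_le_of_abs_mul_le {k N B : ℤ} (hN : 0 < N) (h₁ : -(B * N) ≤ k * N)
    (h₂ : k * N ≤ B * N) : |k| ≤ B :=
  abs_le.2 ⟨le_of_mul_le_mul_right (by linarith) hN, le_of_mul_le_mul_right h₂ hN⟩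

lemma le_templateBound {k : ℤ} (h : |k| ≤ 1 + 4 * a + 2 * α ∨ |k| ≤ α + α * a ∨
    |k| ≤ 2 * a + 2 * a * β ∨ |k| ≤ 1 + α * (4 * a + 2 * a * β)) :
    |k| ≤ templateBound α β a := by
  have h₁ : (0 : ℤ) ≤ α * a := by positivity
  have h₂ : (0 : ℤ) ≤ 2 * a * β := by positivity
  have h₃ : (0 : ℤ) ≤ α * (4 * a + 2 * a * β) := by positivity
  unfold templateBound
  omega

lemma axis_mem_templates (hα : 0 < α) (ha : 0 < a) (i : Fin 3) :
    (fun s : ℕ × ℕ => Pi.single i (NPar α β γ a s.1 s.2 : ℝ)) ∈ templates α β γ a := by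
  have hα' : (α : ℝ) ≠ 0 := by positivity
  have ha' : (a : ℝ) ≠ 0 := by positivity
  have h0 : |(0 : ℤ)| ≤ templateBound α β a := by simpa using (templateBound_pos α β a).le
  have hbα : |(α : ℤ)| ≤ templateBound α β a := le_templateBound (by simp; omega)
  have hba : |(a : ℤ)| ≤ templateBound α β a := le_templateBound (by simp; omega)
  fin_cases i
  · refine ⟨a, 0, 0, hba, h0, h0, Or.inl ⟨by simp, by simp, ?_⟩⟩
    funext s i
    fin_cases i <;> simp [secondSmall, ha']
  · refine ⟨0, α, 0, h0, hbα, h0, Or.inr (Or.inl ⟨by simp, by simp, ?_⟩)⟩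
    funext s i
    fin_cases i <;> simp [thirdSmall, hα']
  · refine ⟨0, 0, a, h0, h0, hba, Or.inl ⟨by simp, by simp, ?_⟩⟩
    funext s i
    fin_cases i <;> simp [secondSmall, ha']

/-- The lattice vector `x (1, a, b) + j (0, N, 0) + l (0, 0, N)`. -/
noncomputable def latticePoint (a b N : ℕ) (x j l : ℤ) : Fin 3 → ℝ :=
  ![(x : ℝ), a * x + N * j, b * x + N * l]

lemma secondSmall_eq {t u : ℕ} (ha : 0 < a) (x j l : ℤ) :
    secondSmall α β γ a (-j) (a * x + NPar α β γ a t u * j) (a * l - bPar α β a t * j) (t, u) =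
      latticePoint a (bPar α β a t) (NPar α β γ a t u) x j l := by
  have ha' : (a : ℝ) ≠ 0 := by positivity
  ext i
  fin_cases i <;> simp [secondSmall, latticePoint] <;> field_simp
  ring

lemma thirdSmall_eq {t u : ℕ} (hα : 0 < α) (x j l : ℤ) :
    thirdSmall α β γ a (x + MPar γ a u * l) (a * (x + MPar γ a u * l) + α * j)
      (bPar α β a t * x + NPar α β γ a t u * l) (t, u) =
      latticePoint a (bPar α β a t) (NPar α β γ a t u) x j l := by
  have hα' : (α : ℝ) ≠ 0 := by positivity
  ext i
  fin_cases i <;> simp [thirdSmall, latticePoint, NPar_eq] <;> field_simp <;> ring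

lemma basisComb_eq {t u : ℕ} (x j l : ℤ) :
    basisComb α β γ a (x + MPar γ a u * l) (α * t * j - l) j (t, u) =
      latticePoint a (bPar α β a t) (NPar α β γ a t u) x j l := by
  ext i
  fin_cases i <;> simp [basisComb, latticePoint, NPar_eq, bPar] <;> ring

/-- If the second coordinate `y` is at most `a` and the others are less than `N`, then the
parameters `k`, `c` in `a x = N k + y` and `a z = N c + b y` are at most `2 a`. -/
lemma exists_template_of_second_le (ha : 0 < a) {t u : ℕ} (hM : 0 < MPar γ a u)
    (hN : 0 < NPar α β γ a t u) {x j l : ℤ}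
    (hx : |x| < NPar α β γ a t u) (hy : |a * x + NPar α β γ a t u * j| ≤ a)
    (hz : |bPar α β a t * x + NPar α β γ a t u * l| < NPar α β γ a t u) :
    ∃ F ∈ templates α β γ a,
      F (t, u) = latticePoint a (bPar α β a t) (NPar α β γ a t u) x j l := by
  have hβ : (bPar α β a t : ℤ) = α * a * t + β := by simp [bPar]
  have hNe : (NPar α β γ a t u : ℤ) = bPar α β a t * MPar γ a u + α := by simp [NPar_eq]
  have hMe : (MPar γ a u : ℤ) = a * u + γ := by simp [MPar]
  have ha' : (1 : ℤ) ≤ a := by exact_mod_cast ha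
  have hM' : (1 : ℤ) ≤ MPar γ a u := by exact_mod_cast hM
  have hN' : (0 : ℤ) < NPar α β γ a t u := by exact_mod_cast hN
  have hb0 : (0 : ℤ) ≤ bPar α β a t := by positivity
  refine ⟨_, ⟨-j, a * x + NPar α β γ a t u * j, a * l - bPar α β a t * j, ?_, ?_, ?_,
    Or.inl ⟨?_, ?_, rfl⟩⟩, secondSmall_eq ha x j l⟩
  · refine le_templateBound (Or.inl ?_)
    have : |-j| ≤ 2 * a := by
      rw [abs_le] at hy
      rw [abs_lt] at hx
      refine abs_le_of_abs_mul_le hN' ?_ ?_ <;> nlinarith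
    omega
  · exact le_templateBound (Or.inl (by omega))
  · refine le_templateBound (Or.inl ?_)
    have hbN : (bPar α β a t : ℤ) ≤ NPar α β γ a t u := by nlinarith
    have : |(a : ℤ) * l - bPar α β a t * j| ≤ 2 * a := by
      have key : ((a : ℤ) * l - bPar α β a t * j) * NPar α β γ a t u =
          a * (bPar α β a t * x + NPar α β γ a t u * l) -
            bPar α β a t * (a * x + NPar α β γ a t u * j) := by ring
      rw [abs_le] at hy
      rw [abs_lt] at hz
      generalize bPar α β a t * x + NPar α β γ a t u * l = z at *
      generalize a * x + NPar α β γ a t u * j = y at *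
      refine abs_le_of_abs_mul_le hN' ?_ ?_ <;> rw [key] <;> nlinarith
    omega
  · refine ⟨x - (α * t * MPar γ a u + β * u) * (-j), ?_⟩
    rw [hNe, hβ, hMe]
    ring
  · refine ⟨l - α * t * j, ?_⟩
    rw [hβ]
    ring

/-- If the third coordinate `z` is at most `α` and the others are less than `N`, then the
parameters `e`, `d` in `α x = N e - M z` and `α y = N d - a M z` are bounded. -/
lemma exists_template_of_third_le (hα : 0 < α) {t u : ℕ} (hb : 0 < bPar α β a t)
    (hN : 0 < NPar α β γ a t u) {x j l : ℤ}
    (hx : |x| < NPar α β γ a t u) (hy : |a * x + NPar α β γ a t u * j| < NPar α β γ a t u)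
    (hz : |bPar α β a t * x + NPar α β γ a t u * l| ≤ α) :
    ∃ F ∈ templates α β γ a,
      F (t, u) = latticePoint a (bPar α β a t) (NPar α β γ a t u) x j l := by
  have hβ : (bPar α β a t : ℤ) = α * a * t + β := by simp [bPar]
  have hNe : (NPar α β γ a t u : ℤ) = bPar α β a t * MPar γ a u + α := by simp [NPar_eq]
  have hα' : (1 : ℤ) ≤ α := by exact_mod_cast hα
  have hb' : (1 : ℤ) ≤ bPar α β a t := by exact_mod_cast hb
  have hN' : (0 : ℤ) < NPar α β γ a t u := by exact_mod_cast hN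
  have hM0 : (0 : ℤ) ≤ MPar γ a u := by positivity
  have ha0 : (0 : ℤ) ≤ a := by positivity
  have hMN : (MPar γ a u : ℤ) ≤ NPar α β γ a t u := by nlinarith
  have hMz : |MPar γ a u * (bPar α β a t * x + NPar α β γ a t u * l)| ≤
      α * NPar α β γ a t u := by
    rw [abs_mul, abs_of_nonneg hM0, mul_comm]
    exact mul_le_mul hz hMN hM0 (by linarith)
  rw [abs_le] at hMz
  refine ⟨_, ⟨x + MPar γ a u * l, a * (x + MPar γ a u * l) + α * j,
    bPar α β a t * x + NPar α β γ a t u * l, ?_, ?_, ?_,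
    Or.inr (Or.inl ⟨?_, ?_, rfl⟩)⟩, thirdSmall_eq hα x j l⟩
  · refine le_templateBound (Or.inl ?_)
    have : |x + MPar γ a u * l| ≤ 2 * α := by
      have key : (x + MPar γ a u * l) * NPar α β γ a t u =
          α * x + MPar γ a u * (bPar α β a t * x + NPar α β γ a t u * l) := by rw [hNe]; ring
      rw [abs_lt] at hx
      refine abs_le_of_abs_mul_le hN' ?_ ?_ <;> rw [key] <;> nlinarith
    omega
  · refine le_templateBound (Or.inr (Or.inl ?_))
    have key : (a * (x + MPar γ a u * l) + α * j) * NPar α β γ a t u =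
        α * (a * x + NPar α β γ a t u * j) +
          a * (MPar γ a u * (bPar α β a t * x + NPar α β γ a t u * l)) := by rw [hNe]; ring
    rw [abs_lt] at hy
    generalize MPar γ a u * (bPar α β a t * x + NPar α β γ a t u * l) = w at *
    generalize a * x + NPar α β γ a t u * j = y at *
    refine abs_le_of_abs_mul_le hN' ?_ ?_ <;> rw [key] <;> nlinarith
  · exact le_templateBound (Or.inl (by omega))
  · refine ⟨-l - a * t * (x + MPar γ a u * l), ?_⟩
    rw [hNe, hβ]
    ring
  · exact ⟨j, by ring⟩

/-- In the remaining region the determinant `b y - a z` is a multiple `c N` of `N` with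
`|c| ≤ 2 a`, which bounds the coordinates in the basis used by `basisComb`. -/
lemma exists_template_of_lt (ha : 0 < a) {t u : ℕ} (hb : 0 < bPar α β a t)
    (hN : 0 < NPar α β γ a t u) {x j l : ℤ} (hM : 0 < MPar γ a u)
    (hx : |x| < NPar α β γ a t u) (hy : |a * x + NPar α β γ a t u * j| < a * MPar γ a u)
    (hz : |bPar α β a t * x + NPar α β γ a t u * l| < bPar α β a t) :
    ∃ F ∈ templates α β γ a,
      F (t, u) = latticePoint a (bPar α β a t) (NPar α β γ a t u) x j l := by
  have hβ : (bPar α β a t : ℤ) = α * a * t + β := by simp [bPar]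
  have hNe : (NPar α β γ a t u : ℤ) = bPar α β a t * MPar γ a u + α := by simp [NPar_eq]
  have ha' : (1 : ℤ) ≤ a := by exact_mod_cast ha
  have hb' : (1 : ℤ) ≤ bPar α β a t := by exact_mod_cast hb
  have hM' : (1 : ℤ) ≤ MPar γ a u := by exact_mod_cast hM
  have hN' : (0 : ℤ) < NPar α β γ a t u := by exact_mod_cast hN
  have hα0 : (0 : ℤ) ≤ α := by positivity
  have hβ0 : (0 : ℤ) ≤ β := by positivity
  have ht0 : (0 : ℤ) ≤ t := by positivity
  have hbN : (bPar α β a t : ℤ) ≤ NPar α β γ a t u := by nlinarith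
  have hMN : (MPar γ a u : ℤ) ≤ NPar α β γ a t u := by nlinarith
  have hj : |j| ≤ 2 * a := by
    rw [abs_lt] at hx hy
    refine abs_le_of_abs_mul_le hN' ?_ ?_ <;> nlinarith
  have hc : |bPar α β a t * j - a * l| ≤ 2 * a := by
    have key : (bPar α β a t * j - a * l) * NPar α β γ a t u =
        bPar α β a t * (a * x + NPar α β γ a t u * j) -
          a * (bPar α β a t * x + NPar α β γ a t u * l) := by ring
    rw [abs_lt] at hy hz
    have h1 : (a : ℤ) * (bPar α β a t * MPar γ a u) ≤ a * NPar α β γ a t u :=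
      mul_le_mul_of_nonneg_left (by linarith) (by linarith)
    generalize a * x + NPar α β γ a t u * j = y at *
    generalize bPar α β a t * x + NPar α β γ a t u * l = z at *
    refine abs_le_of_abs_mul_le hN' ?_ ?_ <;> rw [key] <;> nlinarith
  have hq : |α * t * j - l| ≤ 2 * a + 2 * a * β := by
    have key : a * (α * t * j - l) = (bPar α β a t * j - a * l) - β * j := by rw [hβ]; ring
    have h1 : |(a : ℤ) * (α * t * j - l)| ≤ 2 * a + β * (2 * a) := by
      rw [key]
      refine (abs_sub _ _).trans (add_le_add hc ?_)
      rw [abs_mul, abs_of_nonneg hβ0]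
      exact mul_le_mul_of_nonneg_left hj hβ0
    rw [abs_mul, abs_of_pos (by linarith)] at h1
    nlinarith [abs_nonneg (α * t * j - l)]
  have hp : |x + MPar γ a u * l| ≤ 1 + α * (4 * a + 2 * a * β) := by
    have key : (x + MPar γ a u * l) * bPar α β a t =
        (bPar α β a t * x + NPar α β γ a t u * l) + α * (α * t * j - l) - α * (α * t) * j := by
      rw [hNe]; ring
    have htb : α * (t : ℤ) ≤ bPar α β a t := by
      rw [hβ]
      have : α * (t : ℤ) * 1 ≤ α * t * a :=
        mul_le_mul_of_nonneg_left ha' (mul_nonneg hα0 ht0)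
      linarith
    have h1 : |α * (α * t * j - l)| ≤ α * (2 * a + 2 * a * β) * bPar α β a t := by
      rw [abs_mul, abs_of_nonneg hα0]
      exact (mul_le_mul_of_nonneg_left hq hα0).trans
        (le_mul_of_one_le_right (by positivity) hb')
    have h2 : |α * (α * t) * j| ≤ α * (2 * a) * bPar α β a t := by
      rw [abs_mul, abs_of_nonneg (by positivity)]
      calc (α : ℤ) * (α * t) * |j| ≤ α * bPar α β a t * (2 * a) := by gcongr
        _ = _ := by ring
    rw [abs_le] at h1 h2
    rw [abs_lt] at hz
    refine abs_le_of_abs_mul_le (by linarith : (0 : ℤ) < bPar α β a t) ?_ ?_ <;>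
      rw [key] <;> linarith
  refine ⟨_, ⟨x + MPar γ a u * l, α * t * j - l, j, ?_, ?_, ?_, Or.inr (Or.inr rfl)⟩,
    basisComb_eq x j l⟩
  · exact le_templateBound (Or.inr (Or.inr (Or.inr hp)))
  · exact le_templateBound (Or.inr (Or.inr (Or.inl hq)))
  · exact le_templateBound (Or.inl (by omega))

/-- For `0 < |x| < M` all residues `b x` modulo `N` have absolute value at least `b`. -/
lemma le_abs_of_third_lt (hα : 0 < α) {t u : ℕ} {x l : ℤ} (hx : x ≠ 0)
    (hz : |bPar α β a t * x + NPar α β γ a t u * l| < bPar α β a t) :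
    (MPar γ a u : ℤ) ≤ |x| := by
  by_contra! hxM
  have hNe : (NPar α β γ a t u : ℤ) = bPar α β a t * MPar γ a u + α := by simp [NPar_eq]
  have hα' : (1 : ℤ) ≤ α := by exact_mod_cast hα
  have hb0 : (0 : ℤ) ≤ bPar α β a t := by positivity
  have hM0 : (0 : ℤ) ≤ MPar γ a u := by positivity
  have hx1 : 1 ≤ |x| := Int.one_le_abs hx
  rcases eq_or_ne l 0 with rfl | hl
  · rw [mul_zero, add_zero, abs_mul, abs_of_nonneg hb0] at hz
    nlinarith
  · have hl1 : 1 ≤ |l| := Int.one_le_abs hl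
    have h1 : |NPar α β γ a t u * l| - |bPar α β a t * x| ≤
        |bPar α β a t * x + NPar α β γ a t u * l| := by
      have := abs_sub_abs_le_abs_sub (NPar α β γ a t u * l) (-(bPar α β a t * x))
      rwa [abs_neg, sub_neg_eq_add, add_comm (_ * l)] at this
    have hN0 : (0 : ℤ) ≤ NPar α β γ a t u := by positivity
    rw [abs_mul, abs_mul, abs_of_nonneg hb0, abs_of_nonneg hN0] at h1
    have h2 : (NPar α β γ a t u : ℤ) * 1 ≤ NPar α β γ a t u * |l| :=
      mul_le_mul_of_nonneg_left hl1 hN0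
    have h3 : (bPar α β a t : ℤ) * |x| ≤ bPar α β a t * (MPar γ a u - 1) :=
      mul_le_mul_of_nonneg_left (by omega) hb0
    linarith

theorem exists_template_le (hα : 0 < α) (ha : 0 < a) {t u : ℕ} (hb : 0 < bPar α β a t)
    (hM : 0 < MPar γ a u) {v : Fin 3 → ℝ} (hv : v ∈ familyLattice α β γ a t u) (hv0 : v ≠ 0) :
    ∃ F ∈ templates α β γ a, F (t, u) ≠ 0 ∧ ∀ i, |F (t, u) i| ≤ |v i| := by
  obtain ⟨x, j, l, rfl⟩ := mem_familyLattice.1 hv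
  have hN : 0 < NPar α β γ a t u := by unfold NPar; omega
  have hNr : (NPar α β γ a t u : ℝ) ≠ 0 := by positivity
  -- a point with a coordinate of size at least `N` is dominated by a multiple of a unit vector
  have axis : ∀ i : Fin 3, (NPar α β γ a t u : ℝ) ≤ |(![(x : ℝ), a * x + NPar α β γ a t u * j,
      bPar α β a t * x + NPar α β γ a t u * l] : Fin 3 → ℝ) i| →
      ∃ F ∈ templates α β γ a, F (t, u) ≠ 0 ∧ ∀ i, |F (t, u) i| ≤
        |(![(x : ℝ), a * x + NPar α β γ a t u * j,
          bPar α β a t * x + NPar α β γ a t u * l] : Fin 3 → ℝ) i| := by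
    intro i hi
    refine ⟨_, axis_mem_templates hα ha i, by simpa using hNr, fun k => ?_⟩
    rcases eq_or_ne k i with rfl | hk
    · simpa using hi
    · simp [Pi.single_eq_of_ne hk]
  have self : (∃ F ∈ templates α β γ a, F (t, u) =
      latticePoint a (bPar α β a t) (NPar α β γ a t u) x j l) →
      ∃ F ∈ templates α β γ a, F (t, u) ≠ 0 ∧ ∀ i, |F (t, u) i| ≤
        |(![(x : ℝ), a * x + NPar α β γ a t u * j,
          bPar α β a t * x + NPar α β γ a t u * l] : Fin 3 → ℝ) i| := by
    rintro ⟨F, hF, h⟩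
    exact ⟨F, hF, h ▸ hv0, fun i => by rw [h, latticePoint]⟩
  rcases le_or_gt (NPar α β γ a t u : ℤ) |x| with hx | hx
  · exact axis 0 (by simpa using (by exact_mod_cast hx : (NPar α β γ a t u : ℝ) ≤ |(x : ℝ)|))
  rcases le_or_gt (NPar α β γ a t u : ℤ) |a * x + NPar α β γ a t u * j| with hy | hy
  · exact axis 1 (by simpa using (by exact_mod_cast hy :
      (NPar α β γ a t u : ℝ) ≤ |(a * x + NPar α β γ a t u * j : ℝ)|))
  rcases le_or_gt (NPar α β γ a t u : ℤ) |bPar α β a t * x + NPar α β γ a t u * l| with hz | hz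
  · exact axis 2 (by simpa using (by exact_mod_cast hz :
      (NPar α β γ a t u : ℝ) ≤ |(bPar α β a t * x + NPar α β γ a t u * l : ℝ)|))
  rcases le_or_gt |a * x + NPar α β γ a t u * j| (a : ℤ) with hya | hya
  · exact self (exists_template_of_second_le ha hM hN hx hya hz)
  rcases le_or_gt |bPar α β a t * x + NPar α β γ a t u * l| (α : ℤ) with hzα | hzα
  · exact self (exists_template_of_third_le hα hb hN hx hy hzα)
  -- multiples of `N` below `N` vanish, so that `x ≠ 0` here
  have hx0 : x ≠ 0 := by
    rintro rfl
    have hj : j = 0 := by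
      by_contra hj
      rw [mul_zero, zero_add, abs_mul, Nat.abs_cast] at hy
      have := Int.one_le_abs hj
      nlinarith
    rw [hj] at hya
    simp at hya
    omega
  have h0 : |(0 : ℤ)| ≤ templateBound α β a := by simpa using (templateBound_pos α β a).le
  have h1 : |(1 : ℤ)| ≤ templateBound α β a := le_templateBound (Or.inl (by simp; omega))
  rcases le_or_gt (bPar α β a t : ℤ) |bPar α β a t * x + NPar α β γ a t u * l| with hzb | hzb
  · -- domination by `(1, a, b)`
    refine ⟨_, ⟨1, 0, 0, h1, h0, h0, Or.inr (Or.inr rfl)⟩, fun h => ?_, ?_⟩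
    · simpa [basisComb] using congrFun h 0
    · have e0 : (1 : ℝ) ≤ |(x : ℝ)| := by exact_mod_cast Int.one_le_abs hx0
      have e1 : (a : ℝ) ≤ |(a * x + NPar α β γ a t u * j : ℝ)| := by exact_mod_cast hya.le
      have e2 : (bPar α β a t : ℝ) ≤ |(bPar α β a t * x + NPar α β γ a t u * l : ℝ)| := by
        exact_mod_cast hzb
      intro i
      fin_cases i <;> simpa [basisComb]
  have hMx := le_abs_of_third_lt hα hx0 hzb
  rcases le_or_gt ((a : ℤ) * MPar γ a u) |a * x + NPar α β γ a t u * j| with hyM | hyM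
  · -- domination by `(M, a M, -α)`
    refine ⟨_, ⟨0, 1, 0, h0, h1, h0, Or.inr (Or.inr rfl)⟩, fun h => ?_, ?_⟩
    · have := congrFun h 0
      simp [basisComb] at this
      omega
    · have e0 : (MPar γ a u : ℝ) ≤ |(x : ℝ)| := by exact_mod_cast hMx
      have e1 : (MPar γ a u * a : ℝ) ≤ |(a * x + NPar α β γ a t u * j : ℝ)| := by
        rw [mul_comm]; exact_mod_cast hyM
      have e2 : (α : ℝ) ≤ |(bPar α β a t * x + NPar α β γ a t u * l : ℝ)| := by
        exact_mod_cast hzα.le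
      intro i
      fin_cases i <;> simpa [basisComb]
  · exact self (exists_template_of_lt ha hb hN hM hx hyM hzb)

end Domination

/-! ### Stabilization along a filter -/

section Stabilization

variable {α β γ a : ℕ}

lemma mem_absSet_template_iff (hα : 0 < α) (ha : 0 < a) {F : ℕ × ℕ → Fin 3 → ℝ}
    (hF : F ∈ templates α β γ a) (s : ℕ × ℕ) :
    (fun i => |F s i|) ∈ absSet (familyLattice α β γ a s.1 s.2) ↔ ∃ i, ¬ |F s i| ≤ 0 := by
  have h : (fun i => |F s i|) ≠ 0 ↔ ∃ i, ¬ |F s i| ≤ 0 := by simp [funext_iff]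
  rw [← h]
  exact ⟨fun hm => hm.1, fun hne => ⟨hne, F s, mem_familyLattice_of_mem_templates hα ha hF s, rfl⟩⟩

/-- If the comparisons between the coordinates of templates have the same outcome at `s` and at
`s'`, then the two complexes are equivalent. Comparison with the zero template decides which
templates are to be discarded. -/
lemma latticeEquiv_of_le_iff (hα : 0 < α) (ha : 0 < a) {s s' : ℕ × ℕ}
    (hb : 0 < bPar α β a s.1) (hM : 0 < MPar γ a s.2)
    (hb' : 0 < bPar α β a s'.1) (hM' : 0 < MPar γ a s'.2)
    (h : ∀ F ∈ templates α β γ a, ∀ G ∈ templates α β γ a, ∀ i,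
      |F s i| ≤ |G s i| ↔ |F s' i| ≤ |G s' i|) :
    LatticeEquiv (familyLattice α β γ a s.1 s.2) (familyLattice α β γ a s'.1 s'.2) := by
  have dom : ∀ {s : ℕ × ℕ}, 0 < bPar α β a s.1 → 0 < MPar γ a s.2 →
      ∀ x ∈ absSet (familyLattice α β γ a s.1 s.2), ∃ F : templates α β γ a,
        (fun i => |F.1 s i|) ∈ absSet (familyLattice α β γ a s.1 s.2) ∧
          (fun i => |F.1 s i|) ≤ x := by
    rintro s hb hM x ⟨hx0, v, hv, rfl⟩
    have hv0 : v ≠ 0 := by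
      rintro rfl
      exact hx0 (by ext i; simp)
    obtain ⟨F, hF, hF0, hle⟩ := exists_template_le hα ha hb hM hv hv0
    refine ⟨⟨F, hF⟩, (mem_absSet_template_iff hα ha hF s).2 ?_, hle⟩
    obtain ⟨i, hi⟩ := Function.ne_iff.1 hF0
    exact ⟨i, by simpa using hi⟩
  refine Matching.combEquiv (J := templates α β γ a)
    (C := fun F i => |F.1 s i|) (D := fun F i => |F.1 s' i|)
    ⟨?_, ?_, fun F => ?_, fun F G i => h F.1 F.2 G.1 G.2 i, dom hb hM, dom hb' hM'⟩
  · rintro _ ⟨-, v, -, rfl⟩ i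
    exact abs_nonneg _
  · rintro _ ⟨-, v, -, rfl⟩ i
    exact abs_nonneg _
  · rw [mem_absSet_template_iff hα ha F.2, mem_absSet_template_iff hα ha F.2]
    refine exists_congr fun i => not_congr ?_
    simpa using h F.1 F.2 0 (zero_mem_templates α β γ a) i

lemma coordForm_add (i : Fin 3) (A B C A' B' C' : ℝ) (s : ℕ × ℕ) :
    coordForm α β γ a i A B C s + coordForm α β γ a i A' B' C' s =
      coordForm α β γ a i (A + A') (B + B') (C + C') s := by
  unfold coordForm
  split_ifs <;> ring

lemma coordForm_sub (i : Fin 3) (A B C A' B' C' : ℝ) (s : ℕ × ℕ) :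
    coordForm α β γ a i A B C s - coordForm α β γ a i A' B' C' s =
      coordForm α β γ a i (A - A') (B - B') (C - C') s := by
  unfold coordForm
  split_ifs <;> ring

theorem exists_mem_forall_latticeEquiv (hα : 0 < α) (ha : 0 < a) {l : Filter (ℕ × ℕ)}
    (hpos : ∀ᶠ s in l, 0 < bPar α β a s.1 ∧ 0 < MPar γ a s.2)
    (hsign : ∀ i A B C, SignStable l (coordForm α β γ a i A B C)) :
    ∃ E ∈ l, ∀ s ∈ E, ∀ s' ∈ E,
      LatticeEquiv (familyLattice α β γ a s.1 s.2) (familyLattice α β γ a s'.1 s'.2) := by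
  have hc : ∀ x : templates α β γ a × templates α β γ a × Fin 3,
      ∃ c : Prop, ∀ᶠ s in l, (|x.1.1 s x.2.2| ≤ |x.2.1.1 s x.2.2| ↔ c) := by
    rintro ⟨⟨F, hF⟩, ⟨G, hG⟩, i⟩
    obtain ⟨A, B, C, hF⟩ := exists_coordForm hα ha hF i
    obtain ⟨A', B', C', hG⟩ := exists_coordForm hα ha hG i
    apply exists_eventually_abs_le_iff
    · simpa only [hF, hG, coordForm_sub] using hsign i _ _ _
    · simpa only [hF, hG, coordForm_add] using hsign i _ _ _
  choose c hc using hc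
  have : Finite (templates α β γ a) := (finite_templates α β γ a).to_subtype
  have hE := hpos.and (eventually_all.2 hc)
  refine ⟨_, hE, ?_⟩
  rintro s ⟨⟨hb, hM⟩, hs⟩ s' ⟨⟨hb', hM'⟩, hs'⟩
  exact latticeEquiv_of_le_iff hα ha hb hM hb' hM' fun F hF G hG i =>
    (hs (⟨F, hF⟩, ⟨G, hG⟩, i)).trans (hs' (⟨F, hF⟩, ⟨G, hG⟩, i)).symm

lemma tendsto_MPar (ha : 0 < a) : Tendsto (fun u => (MPar γ a u : ℝ)) atTop atTop :=
  tendsto_natCast_atTop_atTop.comp (tendsto_atTop_mono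
    (fun u => (Nat.le_mul_of_pos_left u ha).trans (Nat.le_add_right _ _)) tendsto_id)

lemma tendsto_bPar (hα : 0 < α) (ha : 0 < a) :
    Tendsto (fun t => (bPar α β a t : ℝ)) atTop atTop :=
  tendsto_natCast_atTop_atTop.comp (tendsto_atTop_mono
    (fun t => (Nat.le_mul_of_pos_left t (Nat.mul_pos hα ha)).trans (Nat.le_add_right _ _))
    tendsto_id)

lemma eventually_bPar_pos (hα : 0 < α) (ha : 0 < a) : ∀ᶠ t in atTop, 0 < bPar α β a t :=
  ((tendsto_bPar hα ha).eventually_gt_atTop 0).mono fun _ h => by exact_mod_cast h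

lemma eventually_MPar_pos (ha : 0 < a) : ∀ᶠ u in atTop, 0 < MPar γ a u :=
  ((tendsto_MPar ha).eventually_gt_atTop 0).mono fun _ h => by exact_mod_cast h

theorem stable_both (hα : 0 < α) (ha : 0 < a) : ∃ t₀ u₀ : ℕ, ∀ t u : ℕ, t₀ < t → u₀ < u →
    LatticeEquiv (familyLattice α β γ a t u) (familyLattice α β γ a t₀ u₀) := by
  have ht : Tendsto (Prod.fst : ℕ × ℕ → ℕ) (atTop ×ˢ atTop) atTop := tendsto_fst
  have hu : Tendsto (Prod.snd : ℕ × ℕ → ℕ) (atTop ×ˢ atTop) atTop := tendsto_snd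
  obtain ⟨E, hE, h⟩ := exists_mem_forall_latticeEquiv (β := β) (γ := γ)
    (l := atTop ×ˢ atTop) hα ha
    ((ht.eventually (eventually_bPar_pos hα ha)).and (hu.eventually (eventually_MPar_pos ha)))
    fun i A B C => by
      unfold coordForm
      split_ifs
      · exact signStable_biaffine ((tendsto_bPar hα ha).comp ht) ((tendsto_MPar ha).comp hu) A B C
      · exact signStable_biaffine ((tendsto_MPar ha).comp hu)
          (tendsto_natCast_atTop_atTop.comp ht) A B C
  rw [prod_atTop_atTop_eq, mem_atTop_sets] at hE
  obtain ⟨⟨t₀, u₀⟩, h₀⟩ := hE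
  exact ⟨t₀, u₀, fun t u ht hu => h (t, u) (h₀ _ ⟨ht.le, hu.le⟩) (t₀, u₀) (h₀ _ le_rfl)⟩

lemma LatticeEquiv.refl {n : ℕ} (Γ : Set (Fin n → ℝ)) : LatticeEquiv Γ Γ :=
  ⟨OrderIso.refl _, fun _ => ⟨rfl, Iff.rfl⟩⟩

/-- The lattice depends on `b` modulo `N` only. -/
lemma rankOneLattice_add_mul (a b N k : ℕ) :
    rankOneLattice a (b + N * k) N = rankOneLattice a b N := by
  ext v
  constructor
  · rintro ⟨x, j, l, rfl⟩
    refine ⟨x, j, l + k * x, ?_⟩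
    ext i
    fin_cases i <;> simp
    ring
  · rintro ⟨x, j, l, rfl⟩
    refine ⟨x, j, l - k * x, ?_⟩
    ext i
    fin_cases i <;> simp
    ring

theorem stable_fst (hα : 0 < α) (ha : 0 < a) (u : ℕ) : ∃ t₀ : ℕ, ∀ t : ℕ, t₀ < t →
    LatticeEquiv (familyLattice α β γ a t u) (familyLattice α β γ a t₀ u) := by
  rcases (MPar γ a u).eq_zero_or_pos with hM | hM
  · -- here `N = α` and `b ≡ β`, so that the lattice does not depend on `t`
    have key : ∀ t, familyLattice α β γ a t u = rankOneLattice a β α := fun t => by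
      have hN : NPar α β γ a t u = α := by rw [NPar_eq, hM, mul_zero, zero_add]
      rw [familyLattice, hN, bPar, mul_assoc, add_comm, rankOneLattice_add_mul]
    exact ⟨0, fun t _ => by rw [key, key]; exact LatticeEquiv.refl _⟩
  · obtain ⟨E, hE, h⟩ := exists_mem_forall_latticeEquiv (α := α) (β := β) (γ := γ)
      (l := map (fun t => (t, u)) atTop) hα ha
      (eventually_map.2 ((eventually_bPar_pos hα ha).mono fun t ht => ⟨ht, hM⟩))
      fun i A B C => by
        have : SignStable atTop fun t => coordForm α β γ a i A B C (t, u) := by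
          unfold coordForm
          split_ifs
          · convert signStable_affine (tendsto_bPar hα ha) (A * MPar γ a u + B) C using 2
            ring
          · convert signStable_affine tendsto_natCast_atTop_atTop
              (MPar γ a u * A) (MPar γ a u * B + C) using 2
            ring
        exact this
    obtain ⟨t₀, h₀⟩ := mem_atTop_sets.1 (mem_map.1 hE)
    exact ⟨t₀, fun t ht => h (t, u) (h₀ _ ht.le) (t₀, u) (h₀ _ le_rfl)⟩

theorem stable_snd (hα : 0 < α) (ha : 0 < a) (t : ℕ) : ∃ u₀ : ℕ, ∀ u : ℕ, u₀ < u →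
    LatticeEquiv (familyLattice α β γ a t u) (familyLattice α β γ a t u₀) := by
  rcases (bPar α β a t).eq_zero_or_pos with hb | hb
  · -- here `N = α`, so that the lattice does not depend on `u`
    have key : ∀ u, familyLattice α β γ a t u = rankOneLattice a 0 α := fun u => by
      rw [familyLattice, NPar_eq, hb, zero_mul, zero_add]
    exact ⟨0, fun u _ => by rw [key, key]; exact LatticeEquiv.refl _⟩
  · obtain ⟨E, hE, h⟩ := exists_mem_forall_latticeEquiv (α := α) (β := β) (γ := γ)
      (l := map (fun u => (t, u)) atTop) hα ha
      (eventually_map.2 ((eventually_MPar_pos ha).mono fun u hu => ⟨hb, hu⟩))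
      fun i A B C => by
        have : SignStable atTop fun u => coordForm α β γ a i A B C (t, u) := by
          unfold coordForm
          split_ifs
          · convert signStable_affine (tendsto_MPar ha)
              (bPar α β a t * A) (bPar α β a t * B + C) using 2
            ring
          · convert signStable_affine (tendsto_MPar ha) (A * t + B) C using 2
            ring
        exact this
    obtain ⟨u₀, h₀⟩ := mem_atTop_sets.1 (mem_map.1 hE)
    exact ⟨u₀, fun u hu => h (t, u) (h₀ _ hu.le) (t, u₀) (h₀ _ le_rfl)⟩

/-- A relation on `ℕ × ℕ` that stabilizes along both variables jointly and along each of them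
separately has finitely many representatives: outside a quadrant there remain finitely many rows
and columns, and each of these is finite up to its own stable part. -/
lemma exists_finset_of_stable {r : ℕ → ℕ → ℕ → ℕ → Prop} (hrefl : ∀ t u, r t u t u)
    (h₁ : ∃ t₀ u₀, ∀ t u, t₀ < t → u₀ < u → r t u t₀ u₀)
    (h₂ : ∀ u, ∃ t₀, ∀ t, t₀ < t → r t u t₀ u)
    (h₃ : ∀ t, ∃ u₀, ∀ u, u₀ < u → r t u t u₀) :
    ∃ P : Finset (ℕ × ℕ), ∀ t u, ∃ p ∈ P, r t u p.1 p.2 := by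
  obtain ⟨t₀, u₀, h₁⟩ := h₁
  choose f hf using h₂
  choose g hg using h₃
  refine ⟨insert (t₀, u₀)
    ((Finset.range (u₀ + 1)).biUnion (fun u => (Finset.range (f u + 1)).image fun t => (t, u)) ∪
      (Finset.range (t₀ + 1)).biUnion fun t => (Finset.range (g t + 1)).image fun u => (t, u)),
    fun t u => ?_⟩
  simp only [Finset.mem_insert, Finset.mem_union, Finset.mem_biUnion, Finset.mem_range,
    Finset.mem_image, Order.lt_add_one_iff]
  rcases le_or_gt u u₀ with hu | hu
  · rcases le_or_gt t (f u) with ht | ht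
    · exact ⟨(t, u), Or.inr (Or.inl ⟨u, hu, t, ht, rfl⟩), hrefl t u⟩
    · exact ⟨(f u, u), Or.inr (Or.inl ⟨u, hu, f u, le_rfl, rfl⟩), hf u t ht⟩
  rcases le_or_gt t t₀ with ht | ht
  · rcases le_or_gt u (g t) with hu | hu
    · exact ⟨(t, u), Or.inr (Or.inr ⟨t, ht, u, hu, rfl⟩), hrefl t u⟩
    · exact ⟨(t, g t), Or.inr (Or.inr ⟨t, ht, g t, le_rfl, rfl⟩), hg t u hu⟩
  · exact ⟨(t₀, u₀), Or.inl rfl, h₁ t u ht hu⟩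

end Stabilization

end MinkowskiVoronoi

theorem theorem3 (α β γ a : ℕ) (hα : 0 < α) (hβ : β < α * a) (hγ : γ < a)
    (hαβ : Nat.gcd α β = 1) (ha : Nat.gcd a (α + β * γ) = 1) :
    (∃ t₀ u₀ : ℕ, ∀ t u : ℕ, t₀ < t → u₀ < u →
      MinkowskiVoronoi.LatticeEquiv (MinkowskiVoronoi.familyLattice α β γ a t u)
        (MinkowskiVoronoi.familyLattice α β γ a t₀ u₀)) ∧
    (∀ u : ℕ, ∃ t₀ : ℕ, ∀ t : ℕ, t₀ < t →
      MinkowskiVoronoi.LatticeEquiv (MinkowskiVoronoi.familyLattice α β γ a t u)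
        (MinkowskiVoronoi.familyLattice α β γ a t₀ u)) ∧
    (∀ t : ℕ, ∃ u₀ : ℕ, ∀ u : ℕ, u₀ < u →
      MinkowskiVoronoi.LatticeEquiv (MinkowskiVoronoi.familyLattice α β γ a t u)
        (MinkowskiVoronoi.familyLattice α β γ a t u₀)) ∧
    (∃ P : Finset (ℕ × ℕ), ∀ t u : ℕ, ∃ p ∈ P,
      MinkowskiVoronoi.LatticeEquiv (MinkowskiVoronoi.familyLattice α β γ a t u)
        (MinkowskiVoronoi.familyLattice α β γ a p.1 p.2)) := by
  have ha' : 0 < a := (Nat.zero_le γ).trans_lt hγ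
  have h₁ := MinkowskiVoronoi.stable_both (β := β) (γ := γ) hα ha'
  have h₂ := MinkowskiVoronoi.stable_fst (β := β) (γ := γ) hα ha'
  have h₃ := MinkowskiVoronoi.stable_snd (β := β) (γ := γ) hα ha'
  exact ⟨h₁, h₂, h₃, MinkowskiVoronoi.exists_finset_of_stable
    (r := fun t u t' u' => MinkowskiVoronoi.LatticeEquiv
      (MinkowskiVoronoi.familyLattice α β γ a t u) (MinkowskiVoronoi.familyLattice α β γ a t' u'))
    (fun _ _ => MinkowskiVoronoi.LatticeEquiv.refl _) h₁ h₂ h₃⟩
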